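/- Let $n\ge 0$ be an integer and let $\mathbb{C}[P]$ be the polynomial ring in the $\binom{n+1}{2}$ entries $p_{ij}=p_{ji}$ of a generic symmetric $n\times n$ matrix $P$. Let $I_n\subset\mathbb{C}[P]$ be the ideal generated by the entries of $P^2-P$. For $0\le d\le n$, set $I_{n,d}=I_n+\langle \operatorname{trace}(P)-d\rangle$, and let $\mathrm{pGr}(d,n)=V(I_{n,d})$ be the projection Grassmannian, that is, the set of complex symmetric $n\times n$ matrices $P$ with $P^2=P$ and $\operatorname{trace}(P)=d$. Then the ideal $I_n$ is radical. For each $d=0,\ldots,n$ the ideal $I_{n,d}$ is prime, and it is the ideal of all polynomials in $\mathbb{C}[P]$ that vanish on $\mathrm{pGr}(d,n)$. The ideal $I_n$ has exactly $n+1$ minimal primes, namely the ideals $I_{n,d}$ for $d=0,1,\ldots,n$, one for each Grassmannian $\mathrm{pGr}(d,n)$, and $$I_n \;=\; \bigcap_{d=0}^{n} I_{n,d}.$$ -/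

import Mathlib

/-- The polynomial ring `ℂ[P]` whose unknowns are the `n(n+1)/2` entries of a symmetric
`n × n` matrix, indexed by unordered pairs of indices. -/
abbrev SymPoly (n : ℕ) : Type := MvPolynomial (Sym2 (Fin n)) ℂ

/-- The generic symmetric `n × n` matrix `P = (p_{ij})`. -/
noncomputable def genericSymm (n : ℕ) : Matrix (Fin n) (Fin n) (SymPoly n) :=
  Matrix.of fun i j => MvPolynomial.X s(i, j)

/-- The ideal `I_n` generated by the entries of `P² - P`. -/
noncomputable def projIdeal (n : ℕ) : Ideal (SymPoly n) :=
  Ideal.span (Set.range fun ij : Fin n × Fin n =>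
    ((genericSymm n) ^ 2 - genericSymm n) ij.1 ij.2)

/-- The ideal `I_{n,d} = I_n + ⟨trace(P) - d⟩`. -/
noncomputable def projGrassIdeal (n d : ℕ) : Ideal (SymPoly n) :=
  projIdeal n ⊔ Ideal.span {(genericSymm n).trace - (d : SymPoly n)}

/-- The projection Grassmannian `pGr(d,n) = V(I_n + ⟨trace(P) - d⟩)`, as a set of points of the
affine space of complex symmetric `n × n` matrices. -/
noncomputable def projGrass (d n : ℕ) : Set (Sym2 (Fin n) → ℂ) :=
  MvPolynomial.zeroLocus ℂ (projGrassIdeal n d)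

/-! The scheme of symmetric idempotents is covered by Cayley charts, one for each set `S` of
coordinates. Expanding `det (P + (1 - P)) = 1` multilinearly in the columns shows that the
denominators `chartDenom S` sum to 1 (`sum_chartDenom`). Where `chartDenom S` is invertible, `P = (1
- K) E (1 - K)⁻¹` with `E` the coordinate projection and `K` skew and off-diagonal, so `P` is
parametrized over a domain (`cayleyHom_factors`). The kernel `chartIdeal S` is therefore prime and
agrees with `I_n` up to powers of `chartDenom S`. Gluing gives that `I_n` is the intersection of the
`chartIdeal S`, hence radical.

Charts with `S` of equal size overlap at an explicit projection (`bridgeProj`), so their ideals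
coincide; the trace separates different sizes. This identifies `I_{n,d}` with `chartIdeal S` for
`S.card = d`, and the Nullstellensatz does the rest. -/

/-- The coordinate projection onto the coordinates in `S`. -/
def coordProj {n : ℕ} (A : Type*) [Zero A] [One A] (S : Finset (Fin n)) :
    Matrix (Fin n) (Fin n) A :=
  Matrix.diagonal fun i => if i ∈ S then 1 else 0

/-- The matrix whose columns with index in `S` are those of `P`, and whose other columns are
those of `1 - P`. -/
def mixMatrix {n : ℕ} {A : Type*} [Ring A] (S : Finset (Fin n)) (P : Matrix (Fin n) (Fin n) A) :
    Matrix (Fin n) (Fin n) A :=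
  P * coordProj A S + (1 - P) * (1 - coordProj A S)

/-! ### Coordinate projections and the partition of unity. -/

section CoordProj

variable {n : ℕ} {A B : Type*} [CommRing A] [CommRing B] (S : Finset (Fin n))

theorem coordProj_mul_self : coordProj A S * coordProj A S = coordProj A S := by
  simp [coordProj, Matrix.diagonal_mul_diagonal, ← ite_and]

theorem coordProj_transpose : (coordProj A S).transpose = coordProj A S := by
  simp [coordProj]

theorem coordProj_trace : (coordProj A S).trace = S.card := by
  simp [coordProj, Matrix.trace_diagonal]

theorem coordProj_map (φ : A →+* B) : φ.mapMatrix (coordProj A S) = coordProj B S := by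
  simp only [coordProj, RingHom.mapMatrix_apply, Matrix.diagonal_map (map_zero φ)]
  congr 1
  ext i
  simp [apply_ite φ]

theorem mixMatrix_map (φ : A →+* B) (P : Matrix (Fin n) (Fin n) A) :
    φ.mapMatrix (mixMatrix S P) = mixMatrix S (φ.mapMatrix P) := by
  simp [mixMatrix, coordProj_map, -RingHom.mapMatrix_apply]

/-- The determinant is multilinear in the columns, and `P + (1 - P) = 1`. -/
theorem sum_det_mixMatrix (P : Matrix (Fin n) (Fin n) A) :
    ∑ S : Finset (Fin n), (mixMatrix S P).det = 1 := by
  have h := (Matrix.detRowAlternating (n := Fin n) (R := A)).toMultilinearMap.map_add_univ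
    (P.transpose) ((1 - P).transpose)
  have h1 : P.transpose + (1 - P).transpose = (1 : Matrix (Fin n) (Fin n) A) := by
    rw [← Matrix.transpose_add]; simp
  have h2 : (Matrix.detRowAlternating (n := Fin n) (R := A)).toMultilinearMap
      (P.transpose + (1 - P).transpose) = 1 := by
    rw [h1]; exact Matrix.det_one
  erw [h2] at h
  rw [h]
  refine Finset.sum_congr rfl fun S _ => ?_
  rw [← Matrix.det_transpose]
  change Matrix.det _ = Matrix.det _
  congr 1
  ext i j
  by_cases hi : i ∈ S <;>
    simp [mixMatrix, coordProj, hi, Matrix.mul_sub, Matrix.mul_diagonal, Finset.piecewise]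

end CoordProj

/-! ### Matrix identities behind the Cayley transform. -/

section Chart

variable {ι A : Type*} [Fintype ι] [DecidableEq ι] [CommRing A]

open Matrix

/-- A skew-symmetric `K` that is off-diagonal with respect to `E` moves the symmetric
idempotent `E` to another symmetric idempotent. -/
theorem cayley_isSymm {E K Q : Matrix ι ι A} (hE : Eᵀ = E) (hK : Kᵀ = -K)
    (hEK : E * K + K * E = K) (hQ : (1 - K) * Q = 1) :
    ((1 - K) * E * Q)ᵀ = (1 - K) * E * Q := by
  have hT : Qᵀ * (1 + K) = 1 := by
    have := congrArg transpose hQ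
    simpa [transpose_mul, hK, sub_neg_eq_add] using this
  -- Off-diagonality says `E K = K (1 - E)`, so passing `K` twice brings `E` back.
  have hcomm : E * (K * K) = K * K * E := by
    have h1 : E * K = K - K * E := eq_sub_of_add_eq hEK
    calc E * (K * K) = (E * K) * K := by rw [mul_assoc]
      _ = (K - K * E) * K := by rw [h1]
      _ = K * K - K * (E * K) := by rw [sub_mul, mul_assoc]
      _ = K * K * E := by rw [h1, mul_sub, sub_sub_cancel, mul_assoc]
  have key : E * (1 + K) * (1 - K) = (1 + K) * (1 - K) * E := by
    have e1 : E * (1 + K) * (1 - K) = E - E * (K * K) := by noncomm_ring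
    have e2 : (1 + K) * (1 - K) * E = E - K * K * E := by noncomm_ring
    rw [e1, e2, hcomm]
  have : ((1 - K) * E * Q)ᵀ = Qᵀ * (E * (1 + K)) := by
    simp [transpose_mul, hK, hE, sub_neg_eq_add]
  rw [this]
  calc Qᵀ * (E * (1 + K)) = Qᵀ * (E * (1 + K) * ((1 - K) * Q)) := by rw [hQ, mul_one]
    _ = Qᵀ * ((E * (1 + K) * (1 - K)) * Q) := by simp only [mul_assoc]
    _ = (Qᵀ * (1 + K)) * ((1 - K) * E * Q) := by rw [key]; simp only [mul_assoc]
    _ = (1 - K) * E * Q := by rw [hT, one_mul]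

theorem conj_mul_self {E U Q : Matrix ι ι A} (hE : E * E = E) (hQ : U * Q = 1) :
    (U * E * Q) * (U * E * Q) = U * E * Q := by
  have hQ' : Q * U = 1 := mul_eq_one_comm.mp hQ
  calc (U * E * Q) * (U * E * Q) = U * E * (Q * U) * E * Q := by simp only [mul_assoc]
    _ = U * (E * E) * Q := by rw [hQ', mul_one]; simp only [mul_assoc]
    _ = U * E * Q := by rw [hE]

theorem conj_trace {E U Q : Matrix ι ι A} (hQ : U * Q = 1) :
    (U * E * Q).trace = E.trace := by
  rw [trace_mul_comm, ← mul_assoc, mul_eq_one_comm.mp hQ, one_mul]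

/-- Two idempotents are intertwined by `E P + (1 - E) (1 - P)`. -/
theorem mix_intertwines {E P : Matrix ι ι A} (hE : E * E = E) (hP : P * P = P) :
    E * (E * P + (1 - E) * (1 - P)) = (E * P + (1 - E) * (1 - P)) * P := by
  have e1 : E * (E * P + (1 - E) * (1 - P)) = E * E * P + (E - E * E) * (1 - P) := by noncomm_ring
  have e2 : (E * P + (1 - E) * (1 - P)) * P = E * (P * P) + (1 - E) * (P - P * P) := by
    noncomm_ring
  rw [e1, e2, hE, hP]; simp

/-- Multiplying the identity `Γ (2E - 1) Γ = Γ E - Γ + E Γ` by `H = Γ⁻¹` on both sides gives `2E - 1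
= E H - H + H E`, which is the claim rearranged. -/
theorem mix_off_diagonal {E P H : Matrix ι ι A} (hE : E * E = E) (hP : P * P = P)
    (hH : H * (E * P + (1 - E) * (1 - P)) = 1) :
    E * (1 - H) + (1 - H) * E = 1 - H := by
  have hi := mix_intertwines hE hP
  set Γ := E * P + (1 - E) * (1 - P) with hΓ
  have hH' : Γ * H = 1 := mul_eq_one_comm.mp hH
  have hΓ2 : Γ = 1 - E - P + 2 * (E * P) := by rw [hΓ]; noncomm_ring
  have hEP : E * Γ = E * P := by
    have : E * (1 - E - P + 2 * (E * P)) = E - E * E - E * P + 2 * (E * E * P) := by noncomm_ring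
    rw [hΓ2, this, hE]; noncomm_ring
  have key : Γ * (2 * E - 1) * Γ = Γ * E - Γ + E * Γ := by
    calc Γ * (2 * E - 1) * Γ = 2 * (Γ * (E * Γ)) - Γ * Γ := by noncomm_ring
      _ = Γ * (E + P - 1) := by rw [hEP]; nth_rewrite 3 [hΓ2]; noncomm_ring
      _ = Γ * E - Γ + Γ * P := by noncomm_ring
      _ = Γ * E - Γ + E * Γ := by rw [hi]
  have h5 : 2 * E - 1 = E * H - H + H * E := by
    calc 2 * E - 1 = (H * Γ) * (2 * E - 1) * (Γ * H) := by rw [hH, hH', one_mul, mul_one]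
      _ = H * (Γ * (2 * E - 1) * Γ) * H := by simp only [mul_assoc]
      _ = (H * Γ) * E * H - (H * Γ) * H + H * E * (Γ * H) := by rw [key]; noncomm_ring
      _ = _ := by rw [hH, hH', one_mul, one_mul, mul_one]
  calc E * (1 - H) + (1 - H) * E = (2 * E - 1) + 1 - E * H - H * E := by noncomm_ring
    _ = _ := by rw [h5]; abel

/-- The relation `Γᵀ + Γ = 2 Γᵀ Γ` becomes `H + Hᵀ = 2` after inverting. -/
theorem mix_skew {E P H : Matrix ι ι A} (hE : E * E = E) (hP : P * P = P)
    (hEt : Eᵀ = E) (hPt : Pᵀ = P)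
    (hH : H * (E * P + (1 - E) * (1 - P)) = 1) : (1 - H)ᵀ = -(1 - H) := by
  set Γ := E * P + (1 - E) * (1 - P) with hΓ
  have hH' : Γ * H = 1 := mul_eq_one_comm.mp hH
  have hHt : Hᵀ * Γᵀ = 1 := by rw [← transpose_mul, hH', transpose_one]
  have hΓt : Γᵀ = P * E + (1 - P) * (1 - E) := by
    rw [hΓ]; simp [transpose_mul, hEt, hPt]
  have e1 : Γᵀ * Γ = 1 - E - P + E * P + P * E := by
    have : Γᵀ * Γ = P * (E * E) * P + (1 - P) * ((1 - E) * (1 - E)) * (1 - P)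
        + P * (E - E * E) * (1 - P) + (1 - P) * (E - E * E) * P := by
      rw [hΓt, hΓ]; noncomm_ring
    have h2 : (1 - E) * (1 - E) = 1 - E := by
      have : (1 - E) * (1 - E) = 1 - E - E + E * E := by noncomm_ring
      rw [this, hE]; abel
    rw [this, h2, hE]
    have : P * E * P + (1 - P) * (1 - E) * (1 - P) + P * (E - E) * (1 - P)
        + (1 - P) * (E - E) * P = 1 - E - P - P + P * P + E * P + P * E + (P * E * P - P * E * P) := by
      noncomm_ring
    rw [this, hP]; abel
  have e2 : Γᵀ + Γ = 2 * (Γᵀ * Γ) := by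
    rw [e1, hΓt, hΓ]; noncomm_ring
  have e3 : H + Hᵀ = 2 := by
    calc H + Hᵀ = (Hᵀ * Γᵀ) * H + Hᵀ * (Γ * H) := by rw [hHt, hH', one_mul, mul_one]
      _ = Hᵀ * (Γᵀ + Γ) * H := by noncomm_ring
      _ = 2 * ((Hᵀ * Γᵀ) * (Γ * H)) := by rw [e2]; noncomm_ring
      _ = 2 := by rw [hHt, hH', mul_one, mul_one]
  rw [transpose_sub, transpose_one, eq_sub_of_add_eq' e3]
  have : (2 : Matrix ι ι A) = 1 + 1 := by norm_num
  rw [this]; abel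

end Chart

/-! ### Cayley charts, their prime ideals and their universal property. -/

section ChartIdeal

open Matrix MvPolynomial

variable {n : ℕ}

/-- The generic skew-symmetric matrix that is off-diagonal with respect to `S`, built from
a matrix `Y`. -/
def offDiagSkew {A : Type*} [CommRing A] (S : Finset (Fin n)) (Y : Matrix (Fin n) (Fin n) A) :
    Matrix (Fin n) (Fin n) A :=
  coordProj A S * Y * (1 - coordProj A S) - (1 - coordProj A S) * Yᵀ * coordProj A S

theorem offDiagSkew_transpose {A : Type*} [CommRing A] (S : Finset (Fin n))
    (Y : Matrix (Fin n) (Fin n) A) : (offDiagSkew S Y)ᵀ = -offDiagSkew S Y := by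
  simp [offDiagSkew, transpose_mul, coordProj_transpose, mul_assoc]

theorem offDiagSkew_off_diagonal {A : Type*} [CommRing A] (S : Finset (Fin n))
    (Y : Matrix (Fin n) (Fin n) A) :
    coordProj A S * offDiagSkew S Y + offDiagSkew S Y * coordProj A S = offDiagSkew S Y := by
  have hE := coordProj_mul_self (A := A) S
  unfold offDiagSkew
  set E := coordProj A S
  have : E * (E * Y * (1 - E) - (1 - E) * Yᵀ * E) + (E * Y * (1 - E) - (1 - E) * Yᵀ * E) * E
      = E * E * Y * (1 - E) - (E - E * E) * Yᵀ * E + E * Y * (E - E * E)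
        - (1 - E) * Yᵀ * (E * E) := by noncomm_ring
  rw [this, hE]; simp

theorem offDiagSkew_eq_self {A : Type*} [CommRing A] (S : Finset (Fin n))
    {K : Matrix (Fin n) (Fin n) A} (hK : Kᵀ = -K)
    (hEK : coordProj A S * K + K * coordProj A S = K) : offDiagSkew S K = K := by
  have hE := coordProj_mul_self (A := A) S
  unfold offDiagSkew
  set E := coordProj A S
  have h1 : E * K * E = 0 := by
    have := congrArg (fun M => E * M) hEK
    simp only [mul_add, ← mul_assoc, hE] at this
    simpa using this
  rw [hK]
  calc E * K * (1 - E) - (1 - E) * -K * E = E * K + K * E - E * K * E - E * K * E := by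
        noncomm_ring
    _ = K := by rw [h1, hEK]; simp

theorem offDiagSkew_map {A B : Type*} [CommRing A] [CommRing B] (φ : A →+* B)
    (S : Finset (Fin n)) (Y : Matrix (Fin n) (Fin n) A) :
    φ.mapMatrix (offDiagSkew S Y) = offDiagSkew S (φ.mapMatrix Y) := by
  have : φ.mapMatrix Yᵀ = (φ.mapMatrix Y)ᵀ := rfl
  simp [offDiagSkew, coordProj_map, this, -RingHom.mapMatrix_apply]

/-- The coordinate ring of the space of all `n × n` matrices. -/
abbrev MatPoly (n : ℕ) : Type := MvPolynomial (Fin n × Fin n) ℂ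

/-- The generic matrix. -/
noncomputable def genericMat (n : ℕ) : Matrix (Fin n) (Fin n) (MatPoly n) :=
  Matrix.of fun i j => X (i, j)

/-- The denominator of the Cayley chart at `S`. -/
noncomputable def cayleyDet (S : Finset (Fin n)) : MatPoly n :=
  (1 - offDiagSkew S (genericMat n)).det

theorem cayleyDet_ne_zero (S : Finset (Fin n)) : cayleyDet S ≠ 0 := by
  intro h
  have h1 := congrArg (MvPolynomial.aeval (R := ℂ) (fun _ : Fin n × Fin n => (0 : ℂ))).toRingHom h
  rw [cayleyDet, RingHom.map_det, map_sub, map_one, offDiagSkew_map] at h1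
  have h2 : (MvPolynomial.aeval (R := ℂ) (fun _ : Fin n × Fin n => (0 : ℂ))).toRingHom.mapMatrix
      (genericMat n) = 0 := by
    ext i j; simp [genericMat]
  rw [h2] at h1
  simp [offDiagSkew] at h1

/-- The coordinate ring of the Cayley chart at `S`. -/
abbrev CayleyRing (S : Finset (Fin n)) : Type := Localization.Away (cayleyDet S)

instance cayleyRing_isDomain (S : Finset (Fin n)) : IsDomain (CayleyRing S) :=
  IsLocalization.isDomain_localization
    (powers_le_nonZeroDivisors_of_noZeroDivisors (cayleyDet_ne_zero S))

/-- The off-diagonal skew-symmetric matrix over the Cayley chart. -/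
noncomputable def cayleySkew (S : Finset (Fin n)) : Matrix (Fin n) (Fin n) (CayleyRing S) :=
  (algebraMap (MatPoly n) (CayleyRing S)).mapMatrix (offDiagSkew S (genericMat n))

theorem cayleySkew_eq (S : Finset (Fin n)) : cayleySkew S =
    offDiagSkew S ((algebraMap (MatPoly n) (CayleyRing S)).mapMatrix (genericMat n)) :=
  offDiagSkew_map _ _ _

theorem isUnit_det_one_sub_cayleySkew (S : Finset (Fin n)) :
    IsUnit (1 - cayleySkew S).det := by
  have : (1 - cayleySkew S).det = algebraMap (MatPoly n) (CayleyRing S) (cayleyDet S) := by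
    refine Eq.trans ?_ (RingHom.map_det _ _).symm
    rw [map_sub, map_one, cayleySkew]
  rw [this]
  exact IsLocalization.Away.algebraMap_isUnit _

/-- The symmetric idempotent over the Cayley chart at `S`. -/
noncomputable def cayleyProj (S : Finset (Fin n)) : Matrix (Fin n) (Fin n) (CayleyRing S) :=
  (1 - cayleySkew S) * coordProj _ S * (1 - cayleySkew S)⁻¹

theorem one_sub_cayleySkew_mul_inv (S : Finset (Fin n)) :
    (1 - cayleySkew S) * (1 - cayleySkew S)⁻¹ = 1 :=
  Matrix.mul_nonsing_inv _ (isUnit_det_one_sub_cayleySkew S)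

theorem cayleyProj_isSymm (S : Finset (Fin n)) : (cayleyProj S)ᵀ = cayleyProj S := by
  refine cayley_isSymm (coordProj_transpose S) ?_ ?_ (one_sub_cayleySkew_mul_inv S)
  · rw [cayleySkew_eq, offDiagSkew_transpose]
  · rw [cayleySkew_eq, offDiagSkew_off_diagonal]

theorem cayleyProj_mul_self (S : Finset (Fin n)) :
    cayleyProj S * cayleyProj S = cayleyProj S :=
  conj_mul_self (coordProj_mul_self S) (one_sub_cayleySkew_mul_inv S)

theorem cayleyProj_trace (S : Finset (Fin n)) : (cayleyProj S).trace = S.card :=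
  (conj_trace (one_sub_cayleySkew_mul_inv S)).trans (coordProj_trace S)

/-- Evaluation of polynomials at a symmetric matrix. -/
noncomputable def evalSymm {A : Type*} [CommRing A] [Algebra ℂ A] (Q : Matrix (Fin n) (Fin n) A)
    (hQ : Qᵀ = Q) : SymPoly n →ₐ[ℂ] A :=
  aeval fun z => Sym2.lift ⟨fun i j => Q i j, fun i j => by
    conv_lhs => rw [← hQ]
    rfl⟩ z

theorem evalSymm_mapMatrix {A : Type*} [CommRing A] [Algebra ℂ A]
    (Q : Matrix (Fin n) (Fin n) A) (hQ : Qᵀ = Q) :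
    (evalSymm Q hQ).toRingHom.mapMatrix (genericSymm n) = Q := by
  ext i j
  simp [evalSymm, genericSymm]

theorem mapMatrix_apply_eq {A : Type*} [CommRing A] (φ : SymPoly n →+* A)
    {Q : Matrix (Fin n) (Fin n) A} (h : φ.mapMatrix (genericSymm n) = Q) (i j : Fin n) :
    φ (genericSymm n i j) = Q i j := by
  rw [← h]; rfl

theorem projIdeal_le_ker {A : Type*} [CommRing A] (φ : SymPoly n →+* A)
    (h : φ.mapMatrix (genericSymm n) * φ.mapMatrix (genericSymm n) =
      φ.mapMatrix (genericSymm n)) : projIdeal n ≤ RingHom.ker φ := by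
  rw [projIdeal, Ideal.span_le]
  rintro _ ⟨⟨i, j⟩, rfl⟩
  have h1 : φ.mapMatrix (genericSymm n ^ 2 - genericSymm n) = 0 := by
    rw [map_sub, map_pow, pow_two, h, sub_self]
  exact congrFun (congrFun h1 i) j

theorem mapMatrix_mul_self_of_le_ker {A : Type*} [CommRing A] (φ : SymPoly n →+* A)
    (h : projIdeal n ≤ RingHom.ker φ) :
    φ.mapMatrix (genericSymm n) * φ.mapMatrix (genericSymm n) =
      φ.mapMatrix (genericSymm n) := by
  rw [← sub_eq_zero, ← pow_two, ← map_pow, ← map_sub]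
  ext i j
  exact h (Ideal.subset_span ⟨(i, j), rfl⟩)

theorem mapMatrix_genericSymm_transpose {A : Type*} [CommRing A] (φ : SymPoly n →+* A) :
    (φ.mapMatrix (genericSymm n))ᵀ = φ.mapMatrix (genericSymm n) := by
  ext i j
  simp [genericSymm, Sym2.eq_swap]

/-- The parametrization of symmetric idempotents by the Cayley chart at `S`. -/
noncomputable def cayleyHom (S : Finset (Fin n)) : SymPoly n →ₐ[ℂ] CayleyRing S :=
  evalSymm (cayleyProj S) (cayleyProj_isSymm S)

/-- The ideal of the closure of the Cayley chart at `S`. -/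
noncomputable def chartIdeal (S : Finset (Fin n)) : Ideal (SymPoly n) :=
  RingHom.ker (cayleyHom S).toRingHom

instance chartIdeal_isPrime (S : Finset (Fin n)) : (chartIdeal S).IsPrime :=
  RingHom.ker_isPrime _

/-- The principal open set on which the Cayley chart at `S` is defined. -/
noncomputable def chartDenom (S : Finset (Fin n)) : SymPoly n :=
  (mixMatrix S (genericSymm n)).det

theorem sum_chartDenom : ∑ S : Finset (Fin n), chartDenom S = 1 :=
  sum_det_mixMatrix _

theorem projIdeal_le_chartIdeal (S : Finset (Fin n)) : projIdeal n ≤ chartIdeal S := by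
  apply projIdeal_le_ker
  rw [cayleyHom, evalSymm_mapMatrix, cayleyProj_mul_self]

theorem trace_sub_card_mem_chartIdeal (S : Finset (Fin n)) :
    (genericSymm n).trace - (S.card : SymPoly n) ∈ chartIdeal S := by
  have h1 : (cayleyHom S).toRingHom (genericSymm n).trace = (cayleyProj S).trace := by
    rw [AddMonoidHom.map_trace]
    change ((cayleyHom S).toRingHom.mapMatrix (genericSymm n)).trace = _
    rw [cayleyHom, evalSymm_mapMatrix]
  rw [chartIdeal, RingHom.mem_ker, map_sub, h1, cayleyProj_trace, map_natCast, sub_self]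

/-- With `Γ = E P + (1 - E)(1 - P)` invertible, `K = 1 - Γ⁻¹` is an admissible Cayley parameter, and
it recovers `P` because `Γ⁻¹ E Γ = P` by `mix_intertwines`. -/
theorem cayleyHom_factors {L : Type*} [CommRing L] [Algebra ℂ L] (S : Finset (Fin n))
    (φ : SymPoly n →ₐ[ℂ] L) (hφ : projIdeal n ≤ RingHom.ker φ.toRingHom)
    (hu : IsUnit (φ (chartDenom S))) :
    ∃ ψ : CayleyRing S →+* L, ψ.comp (cayleyHom S).toRingHom = φ.toRingHom := by
  set P : Matrix (Fin n) (Fin n) L := φ.toRingHom.mapMatrix (genericSymm n) with hPdef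
  have hP : P * P = P := mapMatrix_mul_self_of_le_ker _ hφ
  have hPt : Pᵀ = P := mapMatrix_genericSymm_transpose _
  set E := coordProj L S with hEdef
  have hE : E * E = E := coordProj_mul_self S
  have hEt : Eᵀ = E := coordProj_transpose S
  set Γ := E * P + (1 - E) * (1 - P) with hΓ
  have hdet : IsUnit Γ.det := by
    have h1 : φ (chartDenom S) = (mixMatrix S P).det := by
      rw [hPdef, ← mixMatrix_map, ← RingHom.map_det]; rfl
    have h2 : Γᵀ = mixMatrix S P := by
      simp [hΓ, mixMatrix, transpose_mul, hPt, hEt, ← hEdef]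
    rwa [← det_transpose, h2, ← h1]
  set H := Γ⁻¹ with hHdef
  have hH : H * Γ = 1 := Matrix.nonsing_inv_mul _ hdet
  have hK := mix_skew hE hP hEt hPt hH
  have hEK := mix_off_diagonal hE hP hH
  let ψ₀ : MatPoly n →ₐ[ℂ] L := aeval fun ij => (1 - H) ij.1 ij.2
  have hψ₀ : ψ₀.toRingHom.mapMatrix (genericMat n) = 1 - H := by
    ext i j; simp [ψ₀, genericMat]
  have hψ₁ : ψ₀.toRingHom.mapMatrix (offDiagSkew S (genericMat n)) = 1 - H := by
    rw [offDiagSkew_map, hψ₀, offDiagSkew_eq_self S hK hEK]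
  have hunit : IsUnit (ψ₀.toRingHom (cayleyDet S)) := by
    rw [cayleyDet, RingHom.map_det, map_sub, map_one, hψ₁, sub_sub_cancel]
    exact IsUnit.of_mul_eq_one Γ.det (by rw [← det_mul, hH, det_one])
  let ψ : CayleyRing S →+* L := IsLocalization.Away.lift (cayleyDet S) hunit
  have hψ : ψ.comp (algebraMap (MatPoly n) (CayleyRing S)) = ψ₀.toRingHom :=
    IsLocalization.Away.lift_comp _ hunit
  have hψK : ψ.mapMatrix (cayleySkew S) = 1 - H := by
    rw [← hψ₁, ← hψ]; rfl
  have hψP : ψ.mapMatrix (cayleyProj S) = P := by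
    have h1 : ψ.mapMatrix (1 - cayleySkew S) = H := by
      rw [map_sub, map_one, hψK, sub_sub_cancel]
    have h2 : ψ.mapMatrix ((1 - cayleySkew S)⁻¹) = Γ := by
      have h3 := congrArg ψ.mapMatrix (one_sub_cayleySkew_mul_inv S)
      rw [map_mul, map_one, h1] at h3
      calc _ = Γ * H * ψ.mapMatrix ((1 - cayleySkew S)⁻¹) := by
            rw [mul_eq_one_comm.mp hH, one_mul]
        _ = Γ := by rw [mul_assoc, h3, mul_one]
    rw [cayleyProj, map_mul, map_mul, h1, h2, coordProj_map, mul_assoc,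
      mix_intertwines hE hP, ← mul_assoc, hH, one_mul]
  refine ⟨ψ, ?_⟩
  apply MvPolynomial.ringHom_ext
  · intro r
    have h1 : cayleyHom S (C r) = algebraMap (MatPoly n) (CayleyRing S) (C r) := by
      rw [← MvPolynomial.algebraMap_eq, AlgHom.commutes, ← MvPolynomial.algebraMap_eq,
        ← IsScalarTower.algebraMap_apply]
    have h2 : φ (C r) = ψ₀ (C r) := by
      rw [← MvPolynomial.algebraMap_eq, ← MvPolynomial.algebraMap_eq,
        AlgHom.commutes, AlgHom.commutes]
    change ψ (cayleyHom S (C r)) = φ (C r)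
    rw [h1, h2]
    exact congrArg (fun f => f (C r)) hψ
  · intro z
    induction z with
    | _ i j =>
      have h1 : (cayleyHom S).toRingHom (genericSymm n i j) = cayleyProj S i j :=
        mapMatrix_apply_eq _ (evalSymm_mapMatrix _ (cayleyProj_isSymm S)) i j
      change ψ ((cayleyHom S).toRingHom (genericSymm n i j)) = φ.toRingHom (genericSymm n i j)
      rw [h1, mapMatrix_apply_eq _ hPdef.symm, ← hψP]
      rfl

/-- The factorization is applied to the universal case, the localization of `ℂ[P]/I_n` at
`chartDenom S`: there `a` becomes zero. -/
theorem exists_pow_mul_mem_of_mem_chartIdeal {S : Finset (Fin n)} {a : SymPoly n}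
    (ha : a ∈ chartIdeal S) : ∃ k : ℕ, chartDenom S ^ k * a ∈ projIdeal n := by
  let R := SymPoly n ⧸ projIdeal n
  let f : R := Ideal.Quotient.mk _ (chartDenom S)
  let L := Localization.Away f
  let φ : SymPoly n →ₐ[ℂ] L :=
    (IsScalarTower.toAlgHom ℂ R L).comp (Ideal.Quotient.mkₐ ℂ (projIdeal n))
  have hφ : projIdeal n ≤ RingHom.ker φ.toRingHom := by
    intro x hx
    have : Ideal.Quotient.mk (projIdeal n) x = 0 := Ideal.Quotient.eq_zero_iff_mem.mpr hx
    change algebraMap R L (Ideal.Quotient.mk (projIdeal n) x) = 0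
    rw [this, map_zero]
  obtain ⟨ψ, hψ⟩ := cayleyHom_factors S φ hφ (IsLocalization.Away.algebraMap_isUnit f)
  have h0 : algebraMap R L (Ideal.Quotient.mk (projIdeal n) a) = 0 := by
    have h1 : (cayleyHom S).toRingHom a = 0 := ha
    have h2 := congrArg (fun g => g a) hψ
    simp only [RingHom.comp_apply, h1, map_zero] at h2
    exact h2.symm
  obtain ⟨⟨_, k, rfl⟩, hk⟩ := (IsLocalization.map_eq_zero_iff (Submonoid.powers f) L _).mp h0
  refine ⟨k, Ideal.Quotient.eq_zero_iff_mem.mp ?_⟩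
  rw [map_mul, map_pow]
  exact hk

end ChartIdeal

/-! ### Charts of equal cardinality have the same ideal. -/

section Connectedness

open Matrix MvPolynomial

variable {n : ℕ}

/-- The orthogonal projection onto the span of the coordinate vectors in `U` and `e_i + e_j`. -/
noncomputable def bridgeProj (U : Finset (Fin n)) (i j : Fin n) : Matrix (Fin n) (Fin n) ℂ :=
  coordProj ℂ U + (2⁻¹ : ℂ) • vecMulVec (Pi.single i 1 + Pi.single j 1)
    (Pi.single i 1 + Pi.single j 1)

theorem bridgeProj_transpose (U : Finset (Fin n)) (i j : Fin n) :
    (bridgeProj U i j)ᵀ = bridgeProj U i j := by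
  simp [bridgeProj, coordProj_transpose, transpose_vecMulVec]

theorem bridgeProj_comm (U : Finset (Fin n)) (i j : Fin n) :
    bridgeProj U i j = bridgeProj U j i := by
  simp only [bridgeProj, add_comm]

theorem bridgeProj_mul_self {U : Finset (Fin n)} {i j : Fin n} (hi : i ∉ U) (hj : j ∉ U)
    (hij : i ≠ j) : bridgeProj U i j * bridgeProj U i j = bridgeProj U i j := by
  unfold bridgeProj
  set w : Fin n → ℂ := Pi.single i 1 + Pi.single j 1 with hw
  have h1 : coordProj ℂ U *ᵥ w = 0 := by
    ext k
    rw [coordProj, mulVec_diagonal]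
    by_cases hk : k ∈ U
    · have h1 : k ≠ i := fun h => hi (h ▸ hk)
      have h2 : k ≠ j := fun h => hj (h ▸ hk)
      simp [hw, h1, h2]
    · simp [hk]
  have h2 : w ᵥ* coordProj ℂ U = 0 := by
    rw [← mulVec_transpose, coordProj_transpose, h1]
  have h3 : w ⬝ᵥ w = 2 := by
    simp [hw, hij, hij.symm]; norm_num
  rw [add_mul, mul_add, mul_add, coordProj_mul_self, Matrix.mul_smul, mul_vecMulVec, h1,
    Matrix.smul_mul, vecMulVec_mul, h2, Matrix.smul_mul, Matrix.mul_smul, vecMulVec_mul_vecMulVec,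
    h3]
  simp [smul_smul, vecMulVec_smul]

theorem mixMatrix_transpose_mul {A : Type*} [CommRing A] (S : Finset (Fin n))
    {P : Matrix (Fin n) (Fin n) A} (hP : P * P = P) (hPt : Pᵀ = P) :
    (mixMatrix S P)ᵀ * mixMatrix S P =
      coordProj A S * P * coordProj A S + (1 - coordProj A S) * (1 - P) * (1 - coordProj A S) := by
  have hEt := coordProj_transpose (A := A) S
  unfold mixMatrix
  set E := coordProj A S
  have h1 : (P * E + (1 - P) * (1 - E))ᵀ = E * P + (1 - E) * (1 - P) := by
    simp [transpose_mul, hPt, hEt]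
  have h2 : (E * P + (1 - E) * (1 - P)) * (P * E + (1 - P) * (1 - E)) =
      E * (P * P) * E + (1 - E) * (1 - P - P + P * P) * (1 - E)
        + E * (P - P * P) * (1 - E) + (1 - E) * (P - P * P) * E := by noncomm_ring
  rw [h1, h2, hP]; simp

/-- The Gram matrix is diagonal, so nonvanishing of the determinant can be read off without
computing it. -/
theorem mixMatrix_bridgeProj_transpose_mul {U : Finset (Fin n)} {i j : Fin n} (hi : i ∉ U)
    (hj : j ∉ U) (hij : i ≠ j) :
    (mixMatrix (insert i U) (bridgeProj U i j))ᵀ * mixMatrix (insert i U) (bridgeProj U i j) =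
      diagonal fun k => if k = i ∨ k = j then (2⁻¹ : ℂ) else 1 := by
  rw [mixMatrix_transpose_mul _ (bridgeProj_mul_self hi hj hij) (bridgeProj_transpose U i j)]
  have h1 : (1 : Matrix (Fin n) (Fin n) ℂ) - coordProj ℂ (insert i U) =
      diagonal fun k => if k ∈ insert i U then 0 else 1 := by
    rw [coordProj, ← diagonal_one, diagonal_sub]
    congr 1; ext k; split_ifs <;> simp
  rw [h1]
  ext a b
  simp only [coordProj, Matrix.add_apply, mul_diagonal, diagonal_mul, Matrix.sub_apply, bridgeProj, Matrix.smul_apply,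
    vecMulVec_apply, diagonal_apply, one_apply, Pi.add_apply, Pi.single_apply, Finset.mem_insert,
    smul_eq_mul]
  by_cases hai : a = i
  · subst hai
    by_cases hba : b = a
    · subst hba; simp [hi, hij]
    · by_cases hbj : b = j
      · subst hbj; simp [hi, hj, hij, hij.symm]
      · simp [hi, hba, hbj, Ne.symm hba]
  · by_cases haj : a = j
    · subst haj
      by_cases hba : b = a
      · subst hba; simp [hj, hai]; norm_num
      · by_cases hbi : b = i
        · subst hbi; simp [hj, hai, hba]
        · simp [hj, hai, hba, hbi, Ne.symm hba]
    · by_cases hba : b = a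
      · subst hba
        by_cases hbU : b ∈ U <;> simp [hai, haj, hbU]
      · simp [hai, haj, Ne.symm hba]

theorem det_mixMatrix_bridgeProj_ne_zero {U : Finset (Fin n)} {i j : Fin n} (hi : i ∉ U)
    (hj : j ∉ U) (hij : i ≠ j) : (mixMatrix (insert i U) (bridgeProj U i j)).det ≠ 0 := by
  intro h
  have h1 := congrArg Matrix.det (mixMatrix_bridgeProj_transpose_mul hi hj hij)
  rw [det_mul, h, mul_zero, det_diagonal] at h1
  refine Finset.prod_ne_zero_iff.mpr (fun k _ => ?_) h1.symm
  split_ifs <;> norm_num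

/-- The point `bridgeProj U i j` lies in both charts. -/
theorem chartDenom_notMem_chartIdeal {U : Finset (Fin n)} {i j : Fin n} (hi : i ∉ U)
    (hj : j ∉ U) (hij : i ≠ j) : chartDenom (insert i U) ∉ chartIdeal (insert j U) := by
  intro h
  obtain ⟨k, hk⟩ := exists_pow_mul_mem_of_mem_chartIdeal h
  let φ := (evalSymm (bridgeProj U i j) (bridgeProj_transpose U i j)).toRingHom
  have hφ : φ.mapMatrix (genericSymm n) = bridgeProj U i j := evalSymm_mapMatrix _ _
  have h0 : φ (chartDenom (insert j U) ^ k * chartDenom (insert i U)) = 0 :=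
    projIdeal_le_ker φ (by rw [hφ, bridgeProj_mul_self hi hj hij]) hk
  have hd : ∀ S, φ (chartDenom S) = (mixMatrix S (bridgeProj U i j)).det := fun S => by
    rw [chartDenom, RingHom.map_det, mixMatrix_map, hφ]
  rw [map_mul, map_pow, hd, hd] at h0
  rcases mul_eq_zero.mp h0 with h1 | h1
  · have h2 := eq_zero_of_pow_eq_zero h1
    rw [bridgeProj_comm] at h2
    exact det_mixMatrix_bridgeProj_ne_zero hj hi hij.symm h2
  · exact det_mixMatrix_bridgeProj_ne_zero hi hj hij h1

theorem chartIdeal_insert_le {U : Finset (Fin n)} {i j : Fin n} (hi : i ∉ U)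
    (hj : j ∉ U) (hij : i ≠ j) : chartIdeal (insert i U) ≤ chartIdeal (insert j U) := by
  intro a ha
  obtain ⟨k, hk⟩ := exists_pow_mul_mem_of_mem_chartIdeal ha
  rcases (chartIdeal_isPrime (insert j U)).mem_or_mem (projIdeal_le_chartIdeal _ hk) with h | h
  · exact absurd ((chartIdeal_isPrime _).mem_of_pow_mem _ h) (chartDenom_notMem_chartIdeal hi hj hij)
  · exact h

/-- A function of finite sets that is invariant under exchanging one element for another depends
only on the cardinality. -/
theorem Finset.eq_of_card_eq_of_exchange {α β : Type*} [DecidableEq α] (F : Finset α → β)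
    (hF : ∀ (U : Finset α) (i j : α), i ∉ U → j ∉ U → i ≠ j → F (insert i U) = F (insert j U))
    {S T : Finset α} (h : S.card = T.card) : F S = F T := by
  -- Each exchange of `i ∈ S \ T` for `j ∈ T \ S` lowers `(S \ T).card` by one.
  induction hm : (S \ T).card generalizing S with
  | zero =>
    have : S ⊆ T := Finset.sdiff_eq_empty_iff_subset.mp (Finset.card_eq_zero.mp hm)
    rw [Finset.eq_of_subset_of_card_le this h.ge]
  | succ m ih =>
    have h1 : (S \ T).Nonempty := Finset.card_pos.mp (by omega)
    have h2 : (T \ S).Nonempty := by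
      refine Finset.card_pos.mp ?_
      rw [← Finset.card_sdiff_comm h]; omega
    obtain ⟨i, hi⟩ := h1
    obtain ⟨j, hj⟩ := h2
    rw [Finset.mem_sdiff] at hi hj
    have hjU : j ∉ S.erase i := fun h => hj.2 (Finset.mem_of_mem_erase h)
    have hij : i ≠ j := fun h => hj.2 (h ▸ hi.1)
    have h3 := hF (S.erase i) i j (Finset.notMem_erase i S) hjU hij
    rw [Finset.insert_erase hi.1] at h3
    rw [h3]
    apply ih
    · rw [Finset.card_insert_of_notMem hjU, Finset.card_erase_add_one hi.1, h]
    · have : insert j (S.erase i) \ T = (S \ T).erase i := by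
        rw [Finset.insert_sdiff_of_mem _ hj.1, Finset.erase_sdiff_comm]
      rw [this, Finset.card_erase_of_mem (Finset.mem_sdiff.mpr hi)]
      omega

theorem chartIdeal_eq_of_card_eq {S T : Finset (Fin n)} (h : S.card = T.card) :
    chartIdeal S = chartIdeal T :=
  Finset.eq_of_card_eq_of_exchange chartIdeal (fun _ _ _ hi hj hij =>
    le_antisymm (chartIdeal_insert_le hi hj hij) (chartIdeal_insert_le hj hi hij.symm)) h

end Connectedness

/-- The radical of the colon ideal of `a` contains every `f i`, hence 1. -/
theorem Ideal.mem_of_forall_exists_pow_mul_mem {R ι : Type*} [CommRing R] [Fintype ι] {f : ι → R}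
    (hf : ∑ i, f i = 1) {J : Ideal R} {a : R} (h : ∀ i, ∃ k : ℕ, f i ^ k * a ∈ J) : a ∈ J := by
  have h1 : (1 : R) ∈ (Submodule.colon J {a}).radical := by
    rw [← hf]
    refine Ideal.sum_mem _ fun i _ => ?_
    obtain ⟨k, hk⟩ := h i
    exact ⟨k, Submodule.mem_colon_singleton.mpr hk⟩
  obtain ⟨k, hk⟩ := h1
  simpa using Submodule.mem_colon_singleton.mp hk

/-! ### Gluing the charts and separating components by the trace. -/

section Main

variable {n : ℕ}

theorem mem_projIdeal_of_forall_mem_chartIdeal {a : SymPoly n} (h : ∀ S, a ∈ chartIdeal S) :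
    a ∈ projIdeal n :=
  Ideal.mem_of_forall_exists_pow_mul_mem sum_chartDenom fun S =>
    exists_pow_mul_mem_of_mem_chartIdeal (h S)

theorem natCast_sub_mul_mem {I : Ideal (SymPoly n)} {d e : ℕ} (hde : d ≠ e) {x : SymPoly n}
    (h : ((d : SymPoly n) - (e : SymPoly n)) * x ∈ I) : x ∈ I := by
  have h1 : ((d : ℂ) - e) ≠ 0 := sub_ne_zero.mpr (Nat.cast_injective.ne hde)
  have h2 : ((d : SymPoly n) - (e : SymPoly n)) = MvPolynomial.C ((d : ℂ) - e) := by simp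
  have h3 : MvPolynomial.C ((d : ℂ) - e)⁻¹ * (((d : SymPoly n) - (e : SymPoly n)) * x) = x := by
    rw [h2, ← mul_assoc, ← MvPolynomial.C_mul, inv_mul_cancel₀ h1, MvPolynomial.C_1, one_mul]
  rw [← h3]
  exact I.mul_mem_left _ h

theorem trace_sub_mem_projGrassIdeal (d : ℕ) :
    (genericSymm n).trace - (d : SymPoly n) ∈ projGrassIdeal n d :=
  Ideal.mem_sup_right (Ideal.mem_span_singleton_self _)

theorem projGrassIdeal_eq_chartIdeal (S : Finset (Fin n)) :
    projGrassIdeal n S.card = chartIdeal S := by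
  apply le_antisymm
  · refine sup_le (projIdeal_le_chartIdeal S) ?_
    rw [Ideal.span_singleton_le_iff_mem]
    exact trace_sub_card_mem_chartIdeal S
  · intro a ha
    refine Ideal.mem_of_forall_exists_pow_mul_mem sum_chartDenom fun T => ?_
    by_cases hT : S.card = T.card
    · rw [chartIdeal_eq_of_card_eq hT] at ha
      obtain ⟨k, hk⟩ := exists_pow_mul_mem_of_mem_chartIdeal ha
      exact ⟨k, Ideal.mem_sup_left hk⟩
    -- On the chart at `T` the trace is both `T.card` and `S.card`, so a power of `chartDenom T`
    -- already lies in the ideal.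
    · obtain ⟨k, hk⟩ := exists_pow_mul_mem_of_mem_chartIdeal (trace_sub_card_mem_chartIdeal T)
      refine ⟨k, Ideal.mul_mem_right _ _ (natCast_sub_mul_mem hT ?_)⟩
      have h1 : chartDenom T ^ k * ((genericSymm n).trace - (T.card : SymPoly n)) ∈
          projGrassIdeal n S.card := Ideal.mem_sup_left hk
      have h2 := (projGrassIdeal n S.card).mul_mem_left (chartDenom T ^ k)
        (trace_sub_mem_projGrassIdeal S.card)
      convert Ideal.sub_mem _ h1 h2 using 1
      ring

theorem exists_projGrassIdeal_eq_chartIdeal {d : ℕ} (hd : d ∈ Finset.range (n + 1)) :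
    ∃ S : Finset (Fin n), S.card = d ∧ projGrassIdeal n d = chartIdeal S := by
  obtain ⟨S, -, hS⟩ := Finset.exists_subset_card_eq (s := (Finset.univ : Finset (Fin n)))
    (n := d) (by simpa [Nat.lt_succ_iff] using hd)
  exact ⟨S, hS, hS ▸ projGrassIdeal_eq_chartIdeal S⟩

theorem projGrassIdeal_isPrime {d : ℕ} (hd : d ∈ Finset.range (n + 1)) :
    (projGrassIdeal n d).IsPrime := by
  obtain ⟨S, -, hS⟩ := exists_projGrassIdeal_eq_chartIdeal hd
  exact hS ▸ chartIdeal_isPrime S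

theorem projIdeal_eq_iInf (n : ℕ) :
    projIdeal n = ⨅ d ∈ Finset.range (n + 1), projGrassIdeal n d := by
  apply le_antisymm
  · exact le_iInf₂ fun d _ => le_sup_left
  · intro a ha
    refine mem_projIdeal_of_forall_mem_chartIdeal fun S => ?_
    rw [← projGrassIdeal_eq_chartIdeal]
    have hS : S.card ∈ Finset.range (n + 1) := by
      simpa [Nat.lt_succ_iff] using S.card_le_univ
    exact (iInf₂_le S.card hS : _ ≤ projGrassIdeal n S.card) ha

theorem eq_of_projGrassIdeal_le {d e : ℕ} (he : e ∈ Finset.range (n + 1))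
    (h : projGrassIdeal n d ≤ projGrassIdeal n e) : d = e := by
  by_contra hde
  refine (projGrassIdeal_isPrime he).ne_top ((Ideal.eq_top_iff_one _).mpr ?_)
  refine natCast_sub_mul_mem hde ?_
  convert Ideal.sub_mem _ (trace_sub_mem_projGrassIdeal e) (h (trace_sub_mem_projGrassIdeal d))
    using 1
  ring

theorem minimalPrimes_projIdeal (n : ℕ) :
    (projIdeal n).minimalPrimes = {J | ∃ d ∈ Finset.range (n + 1), J = projGrassIdeal n d} := by
  have key : ∀ J : Ideal (SymPoly n), J.IsPrime → projIdeal n ≤ J →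
      ∃ d ∈ Finset.range (n + 1), projGrassIdeal n d ≤ J := by
    intro J hJ h
    rw [projIdeal_eq_iInf, ← Finset.inf_eq_iInf] at h
    exact hJ.inf_le'.mp h
  ext J
  constructor
  · rintro ⟨⟨hJ, hIJ⟩, hmin⟩
    obtain ⟨d, hd, hdJ⟩ := key J hJ hIJ
    exact ⟨d, hd, le_antisymm (hmin ⟨projGrassIdeal_isPrime hd, le_sup_left⟩ hdJ) hdJ⟩
  · rintro ⟨d, hd, rfl⟩
    refine ⟨⟨projGrassIdeal_isPrime hd, le_sup_left⟩, ?_⟩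
    rintro q ⟨hq, hIq⟩ hqd
    obtain ⟨e, -, heq⟩ := key q hq hIq
    obtain rfl := eq_of_projGrassIdeal_le hd (heq.trans hqd)
    exact heq

theorem ncard_minimalPrimes_projIdeal (n : ℕ) : (projIdeal n).minimalPrimes.ncard = n + 1 := by
  have h : {J | ∃ d ∈ Finset.range (n + 1), J = projGrassIdeal n d} =
      projGrassIdeal n '' (Finset.range (n + 1) : Set ℕ) := by
    ext J
    constructor
    · rintro ⟨d, hd, rfl⟩
      exact ⟨d, hd, rfl⟩
    · rintro ⟨d, hd, rfl⟩
      exact ⟨d, hd, rfl⟩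
  rw [minimalPrimes_projIdeal, h, Set.InjOn.ncard_image, Set.ncard_coe_finset,
    Finset.card_range]
  intro d _ e he hde
  exact eq_of_projGrassIdeal_le he hde.le

theorem isRadical_projIdeal (n : ℕ) : (projIdeal n).IsRadical := by
  rintro a ⟨k, hk⟩
  refine mem_projIdeal_of_forall_mem_chartIdeal fun S => ?_
  exact (chartIdeal_isPrime S).mem_of_pow_mem k (projIdeal_le_chartIdeal S hk)

end Main

theorem mainTheorem3 (n : ℕ) :
    (projIdeal n).IsRadical ∧
    (∀ d ∈ Finset.range (n + 1), (projGrassIdeal n d).IsPrime ∧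
      MvPolynomial.vanishingIdeal ℂ (projGrass d n) = projGrassIdeal n d) ∧
    (projIdeal n).minimalPrimes = {J | ∃ d ∈ Finset.range (n + 1), J = projGrassIdeal n d} ∧
    (projIdeal n).minimalPrimes.ncard = n + 1 ∧
    projIdeal n = ⨅ d ∈ Finset.range (n + 1), projGrassIdeal n d := by
  refine ⟨isRadical_projIdeal n, fun d hd => ⟨projGrassIdeal_isPrime hd, ?_⟩,
    minimalPrimes_projIdeal n, ncard_minimalPrimes_projIdeal n, projIdeal_eq_iInf n⟩
  -- Hilbert's Nullstellensatz; a prime ideal is its own radical.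
  rw [projGrass, MvPolynomial.vanishingIdeal_zeroLocus_eq_radical]
  exact (projGrassIdeal_isPrime hd).radical
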